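/- Let $\varphi=\frac{1+\sqrt5}{2}$ and $\rho=i\sqrt{\varphi}$. There is exactly one family of nonempty compact sets $R_1,R_2,R_3,R_4\subset\mathbb C$ with $$\rho R_1=R_2,\qquad \rho R_2=R_3,\qquad \rho R_3=(1+R_3)\cup R_4,\qquad \rho R_4=(1+R_2)\cup R_1 ,$$ and it consists of the four rectangles $$R_1=[0,\varphi^{-2}]\times[0,\varphi^{-3/2}],\quad R_2=[-\varphi^{-1},0]\times[0,\varphi^{-3/2}],\quad R_3=[-\varphi^{-1},0]\times[-\varphi^{-1/2},0],\quad R_4=[0,\varphi^{-2}]\times[-\varphi^{-1/2},0],$$ where $[a,b]\times[c,d]$ denotes $\{x+iy: a\le x\le b,\ c\le y\le d\}$. Applying the equations $n$ times subdivides $\rho^nR_i$ into finitely many translates $\omega+R_j$ (its tiles, $\omega+R_j$ being a tile of type $j$), whose union is $\rho^n R_i$. Let the special tessellation $\mathcal T$ be the set of all tiles that occur in these subdivisions, for all $n\ge 0$ and all $i$. Then: (a) $\mathcal T$ is a tessellation of $\mathbb C$ (its members cover $\mathbb C$, and any two different members meet in a set of measure $0$), and it is inflationary with radix $\rho$: for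 every tile $t\in\mathcal T$ the set $\rho t$ is a union of finitely many tiles of $\mathcal T$. (b) Let $U=(U_{ij})$, where $U_{ij}$ is the number of tiles of type $j$ in the subdivision of $\rho R_i$ (the partition matrix). Then $$U=\begin{pmatrix}0&1&0&0\\0&0&1&0\\0&0&1&1\\1&1&0&0\end{pmatrix},$$ the number of tiles of type $j$ in the subdivision of $\rho^nR_i$ is $(U^n)_{ij}$ for all $n\ge 0$, the largest real eigenvalue of $U$ is $\varphi$, and every other complex eigenvalue of $U$ has modulus less than $\varphi$. (c) For each $j$ the density of the tile type $j$, $\lim_{n\to\infty}(U^n)_{ij}/\sum_k (U^n)_{ik}$, exists, does not depend on $i$, and is irrational. (d) $\mathcal T$ is not periodic: no translation by a nonzero $w\in\mathbb C$ maps $\mathcal T$ onto itself. -/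

import Mathlib

open Filter Topology MeasureTheory

namespace SpecialTessellation

noncomputable section

/-- The radix `ρ = i √φ`, where `φ` is the golden number. -/
def radix : ℂ := Complex.I * (Real.sqrt Real.goldenRatio : ℂ)

/-- `ρ s`. -/
def inflate (s : Set ℂ) : Set ℂ := (fun z => radix * z) '' s

/-- `w + s`. -/
def shift (w : ℂ) (s : Set ℂ) : Set ℂ := (fun z => w + z) '' s

/-- The four set equations of the special tessellation, for nonempty compact sets.
The set `R_k` of the text (`k = 1, 2, 3, 4`) is `R (k - 1)`. -/
structure IsTileSystem (R : Fin 4 → Set ℂ) : Prop where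
  nonempty : ∀ i, (R i).Nonempty
  compact : ∀ i, IsCompact (R i)
  eq_one : inflate (R 0) = R 1
  eq_two : inflate (R 1) = R 2
  eq_three : inflate (R 2) = shift 1 (R 2) ∪ R 3
  eq_four : inflate (R 3) = shift 1 (R 1) ∪ R 0

/-- The four rectangular tile types, one in each closed quadrant of the plane. -/
def tile : Fin 4 → Set ℂ :=
  let φ := Real.goldenRatio
  ![Set.Icc 0 (1 / φ ^ 2) ×ℂ Set.Icc 0 (√φ / φ ^ 2),
    Set.Icc (-(1 / φ)) 0 ×ℂ Set.Icc 0 (√φ / φ ^ 2),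
    Set.Icc (-(1 / φ)) 0 ×ℂ Set.Icc (-(√φ / φ)) 0,
    Set.Icc 0 (1 / φ ^ 2) ×ℂ Set.Icc (-(√φ / φ)) 0]

/-- The substitution read off from the four set equations: `(δ, j) ∈ children i` means that
the inflated tile `ρ R_i` contains the piece `δ + R_j`, with digit `δ ∈ {0, 1}`. -/
def children : Fin 4 → Finset (ℕ × Fin 4) :=
  ![{(0, 1)}, {(0, 2)}, {(1, 2), (0, 3)}, {(1, 1), (0, 0)}]

/-- The `n`-fold subdivision of `ρ ^ n R_i` into translated tiles: `(j, ω) ∈ patch n i` means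
that `ω + R_j` is one of its pieces. -/
def patch : ℕ → Fin 4 → Set (Fin 4 × ℂ)
  | 0, i => {(i, 0)}
  | n + 1, i => {p | ∃ q ∈ patch n i, ∃ c ∈ children q.1, p = (c.2, radix * q.2 + (c.1 : ℂ))}

/-- The special tessellation: all the tiles that occur in the subdivisions of the
inflations `ρ ^ n R_i`. -/
def tessellation : Set (Set ℂ) :=
  {t | ∃ (n : ℕ) (i : Fin 4), ∃ p ∈ patch n i, t = shift p.2 (tile p.1)}

/-- A family of sets is a tessellation of `ℂ` if it covers `ℂ` and its members are
pairwise essentially disjoint. -/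
def IsTessellation (T : Set (Set ℂ)) : Prop :=
  ⋃₀ T = Set.univ ∧ T.Pairwise (fun s t => volume (s ∩ t) = 0)

/-- `w` is a period of the family `T` of sets if translation by `w` maps `T` onto itself. -/
def IsPeriod (T : Set (Set ℂ)) (w : ℂ) : Prop := shift w '' T = T

/-- `T` is periodic if it has a nonzero period. -/
def IsPeriodic (T : Set (Set ℂ)) : Prop := ∃ w : ℂ, w ≠ 0 ∧ IsPeriod T w

/-- The partition matrix: its `(i, j)` entry is the number of tiles of type `j` in the
subdivision of `ρ R_i`. -/
def partitionMatrix : Matrix (Fin 4) (Fin 4) ℕ :=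
  Matrix.of fun i j => ((children i).filter (fun c => c.2 = j)).card

/-- The number of tiles of type `j` in the subdivision of `ρ ^ n R_i`. -/
def tileCount (n : ℕ) (i j : Fin 4) : ℕ := {ω : ℂ | (j, ω) ∈ patch n i}.ncard

/-- `d` is the density of the tile type `j`: the limit of the proportion of tiles of type `j`
in the subdivision of `ρ ^ n R_i`, for every starting type `i`. -/
def HasTypeDensity (j : Fin 4) (d : ℝ) : Prop :=
  ∀ i, Tendsto (fun n => (tileCount n i j : ℝ) / ∑ k, (tileCount n i k : ℝ)) atTop (𝓝 d)

end

end SpecialTessellation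

open SpecialTessellation

/-!
Multiplication by `ρ = i √φ` is an expansion by `√φ > 1`, and `ρ² = -φ`. That the four rectangles
solve the set equations is a computation with `φ² = φ + 1`, done in the coordinates `x + i √φ y`, in
which all corners lie in `ℤ[φ]` (`inflate_tile`). Uniqueness is the usual argument for
graph-directed contractions: undoing `n` inflations brings the two solutions within
`C |ρ|⁻ⁿ` of each other (`IsTileSystem.subset`).

The four tiles overlap only along the axes, and the two parts of an inflated tile only along a
vertical line; since inflation preserves null sets, all pieces of the `n`-th subdivisions of the
four tiles overlap in null sets (`volume_piece_inter`). As every type `i` is the part with digit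
`0` of the inflated type `i - 1`, the subdivisions are nested (`patch_subset_patch_succ`), so any
two members of the tessellation occur at a common level. They cover the plane because the four
types together are a neighbourhood of `0`, which the powers of `ρ` blow up to the whole plane.

Pieces have positive measure, so a piece determines the one it comes from (`eq_of_child_eq`).
Hence the tile counts satisfy the linear recursion given by the partition matrix, whose
characteristic polynomial is `(z² + 1) (z² - z - 1)`. The eigenvalues other than `φ` are `± i` and
the conjugate `ψ` of `φ`, of modulus at most `1`, so the counts, divided by `φⁿ`, converge to a
multiple of the left Perron eigenvector `(1, φ, φ + 1, φ)` (`tendsto_tileCount_div_pow`), which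
gives densities in `ℚ(φ)` outside `ℚ`.

Absence of periods rests on `φ` being a Pisot number. The offsets of the tiles are
`∑ δₖ ρᵏ` with digits `0` and `1`; their coordinates lie in `ℤ[φ]`, and replacing `φ` by `ψ` turns
the expansion into a contraction, so that the conjugates of the coordinates are bounded
(`conjBound_of_mem_patch`). If `w` is a period, the translates by `k w`, `k ∈ ℕ`, of the tile `R₁`
all belong to the tessellation, so the conjugates of the coordinates of `k w` are bounded in `k`.
Therefore those of `w` vanish, and `w = 0` (`eq_zero_of_conjBound`).
-/

namespace SpecialTessellation

/-! ### The golden number and the radix -/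

local notation "φ" => Real.goldenRatio
local notation "ψ" => Real.goldenConj

lemma sqrt_golden_mul_self : √φ * √φ = φ := Real.mul_self_sqrt Real.goldenRatio_pos.le

lemma sqrt_golden_pos : 0 < √φ := Real.sqrt_pos.2 Real.goldenRatio_pos

lemma one_div_golden : 1 / φ = φ - 1 := by
  have h := Real.goldenRatio_sq
  have h0 := Real.goldenRatio_ne_zero
  rw [div_eq_iff h0]
  linear_combination -h

lemma one_div_golden_sq : 1 / φ ^ 2 = 2 - φ := by
  have h := Real.goldenRatio_sq
  have h0 := Real.goldenRatio_ne_zero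
  rw [div_eq_iff (pow_ne_zero 2 h0), h]
  linear_combination h

lemma golden_lt_two : φ < 2 := Real.goldenRatio_lt_two

lemma norm_radix : ‖radix‖ = √φ := by
  rw [radix, norm_mul, Complex.norm_I, one_mul, Complex.norm_real,
    Real.norm_of_nonneg sqrt_golden_pos.le]

lemma one_lt_norm_radix : 1 < ‖radix‖ := by
  rw [norm_radix, Real.lt_sqrt (by norm_num)]
  simpa using Real.one_lt_goldenRatio

lemma radix_ne_zero : radix ≠ 0 := by
  rw [← norm_pos_iff]
  linarith [one_lt_norm_radix]

lemma radix_mul_re (z : ℂ) : (radix * z).re = -(√φ * z.im) := by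
  simp [radix]

lemma radix_mul_im (z : ℂ) : (radix * z).im = √φ * z.re := by
  simp [radix]

/-! ### The set equations of the rectangles -/

lemma mem_shift {w z : ℂ} {s : Set ℂ} : z ∈ shift w s ↔ z - w ∈ s := by
  constructor
  · rintro ⟨y, hy, rfl⟩
    simpa using hy
  · exact fun h => ⟨z - w, h, by simp⟩

lemma mem_inflate {z : ℂ} {s : Set ℂ} : z ∈ inflate s ↔ z / radix ∈ s := by
  constructor
  · rintro ⟨y, hy, rfl⟩
    simpa [mul_div_cancel_left₀ _ radix_ne_zero] using hy
  · exact fun h => ⟨z / radix, h, mul_div_cancel₀ _ radix_ne_zero⟩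

lemma radix_mul_mem_inflate {z : ℂ} {s : Set ℂ} : radix * z ∈ inflate s ↔ z ∈ s := by
  rw [mem_inflate, mul_div_cancel_left₀ _ radix_ne_zero]

lemma shift_zero (s : Set ℂ) : shift 0 s = s := by
  ext z
  simp [mem_shift]

lemma shift_shift (v w : ℂ) (s : Set ℂ) : shift v (shift w s) = shift (v + w) s := by
  ext z
  simp [mem_shift, sub_sub]

lemma inflate_shift (w : ℂ) (s : Set ℂ) :
    inflate (shift w s) = shift (radix * w) (inflate s) := by
  ext z
  rw [mem_inflate, mem_shift, mem_shift, mem_inflate, sub_div,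
    mul_div_cancel_left₀ _ radix_ne_zero]

/-- The four set equations in one formula, with the digits read off from `children`. -/
lemma isTileSystem_iff (R : Fin 4 → Set ℂ) :
    IsTileSystem R ↔ (∀ i, (R i).Nonempty) ∧ (∀ i, IsCompact (R i)) ∧
      ∀ i, inflate (R i) = ⋃ c ∈ children i, shift (c.1 : ℂ) (R c.2) := by
  constructor
  · intro h
    refine ⟨h.nonempty, h.compact, fun i => ?_⟩
    fin_cases i
    · simpa [children, shift_zero] using h.eq_one
    · simpa [children, shift_zero] using h.eq_two
    · simpa [children, shift_zero] using h.eq_three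
    · simpa [children, shift_zero] using h.eq_four
  · rintro ⟨h1, h2, h3⟩
    refine ⟨h1, h2, ?_, ?_, ?_, ?_⟩
    · simpa [children, shift_zero] using h3 0
    · simpa [children, shift_zero] using h3 1
    · simpa [children, shift_zero] using h3 2
    · simpa [children, shift_zero] using h3 3

/-- Left end of the real projection of the tile types. -/
noncomputable def tileLeft : Fin 4 → ℝ := ![0, 1 - φ, 1 - φ, 0]

/-- Right end of the real projection of the tile types. -/
noncomputable def tileRight : Fin 4 → ℝ := ![2 - φ, 0, 0, 2 - φ]

/-- Lower end of the imaginary projection of the tile types, in units of `√φ`. -/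
noncomputable def tileBottom : Fin 4 → ℝ := ![0, 0, 1 - φ, 1 - φ]

/-- Upper end of the imaginary projection of the tile types, in units of `√φ`. -/
noncomputable def tileTop : Fin 4 → ℝ := ![2 - φ, 2 - φ, 0, 0]

lemma tile_eq (i : Fin 4) : tile i =
    Set.Icc (tileLeft i) (tileRight i) ×ℂ Set.Icc (√φ * tileBottom i) (√φ * tileTop i) := by
  have h1 : √φ / φ ^ 2 = √φ * (2 - φ) := by rw [← one_div_golden_sq]; ring
  have h2 : -(√φ / φ) = √φ * (1 - φ) := by
    rw [show (1 - φ) = -(φ - 1) by ring, ← one_div_golden]; ring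
  have h3 : -(1 / φ) = 1 - φ := by rw [one_div_golden]; ring
  simp only [tile, h1, h2, h3, one_div_golden_sq]
  fin_cases i <;> simp [tileLeft, tileRight, tileBottom, tileTop]

lemma mem_tile {i : Fin 4} {z : ℂ} : z ∈ tile i ↔
    (tileLeft i ≤ z.re ∧ z.re ≤ tileRight i) ∧
      (√φ * tileBottom i ≤ z.im ∧ z.im ≤ √φ * tileTop i) := by
  rw [tile_eq, Complex.mem_reProdIm, Set.mem_Icc, Set.mem_Icc]

/-- Membership in a tile type, with the imaginary part in units of `√φ`. -/
lemma mk_mem_tile {i : Fin 4} {x y : ℝ} : (⟨x, √φ * y⟩ : ℂ) ∈ tile i ↔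
    (tileLeft i ≤ x ∧ x ≤ tileRight i) ∧ (tileBottom i ≤ y ∧ y ≤ tileTop i) := by
  rw [mem_tile]
  simp only [mul_le_mul_iff_right₀ sqrt_golden_pos]

lemma exists_eq_mk (z : ℂ) : ∃ x y : ℝ, z = ⟨x, √φ * y⟩ :=
  ⟨z.re, z.im / √φ, Complex.ext rfl (mul_div_cancel₀ _ sqrt_golden_pos.ne').symm⟩

lemma radix_mul_mk (x y : ℝ) : radix * ⟨x, √φ * y⟩ = ⟨-(φ * y), √φ * x⟩ := by
  apply Complex.ext
  · rw [radix_mul_re]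
    linear_combination (-y) * sqrt_golden_mul_self
  · rw [radix_mul_im]

lemma inflate_tile (i : Fin 4) :
    inflate (tile i) = ⋃ c ∈ children i, shift (c.1 : ℂ) (tile c.2) := by
  have hφ := Real.goldenRatio_sq
  have h0 := Real.goldenRatio_pos
  have h1 := Real.one_lt_goldenRatio
  have h2 := golden_lt_two
  ext z
  obtain ⟨w, rfl⟩ : ∃ w, z = radix * w := ⟨z / radix, (mul_div_cancel₀ _ radix_ne_zero).symm⟩
  obtain ⟨x, y, rfl⟩ := exists_eq_mk w
  rw [radix_mul_mem_inflate, mk_mem_tile, radix_mul_mk]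
  have hs : ∀ x y : ℝ, ∀ n : ℕ, (⟨x, √φ * y⟩ : ℂ) - n = ⟨x - n, √φ * y⟩ := by
    intro x y n
    apply Complex.ext <;> simp
  simp only [Set.mem_iUnion, mem_shift, hs, mk_mem_tile]
  -- multiplication by `φ` of the bounds on `y`, using `φ (φ - 1) = 1` and `φ (2 - φ) = φ - 1`
  have e1 : y ≤ 2 - φ ↔ 1 - φ ≤ -(φ * y) := by
    rw [← mul_le_mul_iff_right₀ h0]; constructor <;> intro <;> nlinarith
  have e2 : 0 ≤ y ↔ -(φ * y) ≤ 0 := by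
    rw [← mul_le_mul_iff_right₀ h0]; constructor <;> intro <;> nlinarith
  have e3 : 1 - φ ≤ y ↔ -(φ * y) ≤ 1 := by
    rw [← mul_le_mul_iff_right₀ h0]; constructor <;> intro <;> nlinarith
  have e4 : y ≤ 0 ↔ 0 ≤ -(φ * y) := by
    rw [← mul_le_mul_iff_right₀ h0]; constructor <;> intro <;> nlinarith
  fin_cases i
  · simp [children, tileLeft, tileRight, tileBottom, tileTop, e1, e2]
    tauto
  · simp [children, tileLeft, tileRight, tileBottom, tileTop, e1, e2]
    tauto
  all_goals
    simp only [children, Fin.reduceFinMk, Matrix.cons_val, Finset.mem_insert,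
      Finset.mem_singleton, exists_prop, exists_eq_or_imp, exists_eq_left]
    simp [-Left.nonneg_neg_iff, -Left.neg_nonpos_iff, tileLeft, tileRight, tileBottom, tileTop,
      e3, e4]
    constructor
    · rintro ⟨⟨_, _⟩, _, _⟩
      rcases le_total (2 - φ) (-(φ * y)) with h | h
      · left; refine ⟨⟨?_, ?_⟩, ?_, ?_⟩ <;> linarith
      · right; refine ⟨⟨?_, ?_⟩, ?_, ?_⟩ <;> linarith
    · rintro (⟨⟨_, _⟩, _, _⟩ | ⟨⟨_, _⟩, _, _⟩) <;> refine ⟨⟨?_, ?_⟩, ?_, ?_⟩ <;> linarith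

/-- The lower left corner of a tile type belongs to it. -/
lemma corner_mem_tile (i : Fin 4) : (⟨tileLeft i, √φ * tileBottom i⟩ : ℂ) ∈ tile i := by
  have h1 := Real.one_lt_goldenRatio
  have h2 := golden_lt_two
  rw [mk_mem_tile]
  fin_cases i <;> simp [tileLeft, tileRight, tileBottom, tileTop, h1.le, h2.le]

lemma isTileSystem_tile : IsTileSystem tile := by
  rw [isTileSystem_iff]
  refine ⟨fun i => ⟨_, corner_mem_tile i⟩, fun i => ?_, inflate_tile⟩
  rw [tile_eq]
  exact isCompact_Icc.reProdIm isCompact_Icc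

/-! ### Uniqueness of the tile system -/

/-- Iterating the set equations `n` times brings a point of `R i` within distance
`C * |ρ| ^ (-n)` of `S i`, because division by `ρ` is a contraction. -/
lemma IsTileSystem.subset {R S : Fin 4 → Set ℂ} (hR : IsTileSystem R) (hS : IsTileSystem S)
    (i : Fin 4) : R i ⊆ S i := by
  obtain ⟨-, cR, eR⟩ := (isTileSystem_iff R).1 hR
  obtain ⟨nS, cS, eS⟩ := (isTileSystem_iff S).1 hS
  obtain ⟨C, hC⟩ : ∃ C, ∀ j, ∀ x ∈ R j, ∀ y ∈ S j, dist x y ≤ C := by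
    have hb : Bornology.IsBounded (⋃ j, (R j ∪ S j)) :=
      (isCompact_iUnion fun j => (cR j).union (cS j)).isBounded
    obtain ⟨C, hC⟩ := Metric.isBounded_iff.1 hb
    exact ⟨C, fun j x hx y hy => hC (Set.mem_iUnion.2 ⟨j, Or.inl hx⟩)
      (Set.mem_iUnion.2 ⟨j, Or.inr hy⟩)⟩
  have key : ∀ n : ℕ, ∀ j, ∀ x ∈ R j, ∃ y ∈ S j, dist x y ≤ C * (‖radix‖⁻¹) ^ n := by
    intro n
    induction n with
    | zero =>
      intro j x hx
      obtain ⟨y, hy⟩ := nS j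
      exact ⟨y, hy, by simpa using hC j x hx y hy⟩
    | succ n ih =>
      intro j x hx
      have hx' := radix_mul_mem_inflate.2 hx
      rw [eR j] at hx'
      simp only [Set.mem_iUnion] at hx'
      obtain ⟨c, hc, hxc⟩ := hx'
      obtain ⟨y', hy', hd⟩ := ih c.2 _ (mem_shift.1 hxc)
      have hy : y' + (c.1 : ℂ) ∈ inflate (S j) := by
        rw [eS j]
        simp only [Set.mem_iUnion]
        exact ⟨c, hc, mem_shift.2 (by simpa using hy')⟩
      refine ⟨_, mem_inflate.1 hy, ?_⟩
      have e : x - (y' + (c.1 : ℂ)) / radix = (radix * x - c.1 - y') * radix⁻¹ := by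
        have := radix_ne_zero
        field_simp
        ring
      rw [dist_eq_norm, e, norm_mul, norm_inv, pow_succ, ← mul_assoc, ← dist_eq_norm]
      gcongr
  intro x hx
  rw [← (cS i).isClosed.closure_eq, Metric.mem_closure_iff]
  intro ε hε
  have ht : Tendsto (fun n : ℕ => C * (‖radix‖⁻¹) ^ n) atTop (𝓝 (C * 0)) :=
    (tendsto_pow_atTop_nhds_zero_of_lt_one (by positivity)
      (inv_lt_one_of_one_lt₀ one_lt_norm_radix)).const_mul C
  rw [mul_zero] at ht
  obtain ⟨n, hn⟩ := (ht.eventually (gt_mem_nhds hε)).exists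
  obtain ⟨y, hy, hd⟩ := key n i x hx
  exact ⟨y, hy, hd.trans_lt hn⟩

/-! ### Subdivision into pieces -/

/-- The translated tile described by a pair (type, offset). -/
def piece (p : Fin 4 × ℂ) : Set ℂ := shift p.2 (tile p.1)

/-- The part of `ρ • piece q` with digit and type given by `c ∈ children q.1`. -/
noncomputable def child (q : Fin 4 × ℂ) (c : ℕ × Fin 4) : Fin 4 × ℂ := (c.2, radix * q.2 + (c.1 : ℂ))

lemma mem_patch_succ {n : ℕ} {i : Fin 4} {p : Fin 4 × ℂ} :
    p ∈ patch (n + 1) i ↔ ∃ q ∈ patch n i, ∃ c ∈ children q.1, p = child q c := Iff.rfl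

lemma mem_patch_zero {i : Fin 4} {p : Fin 4 × ℂ} : p ∈ patch 0 i ↔ p = (i, 0) := Iff.rfl

lemma inflate_piece (q : Fin 4 × ℂ) :
    inflate (piece q) = ⋃ c ∈ children q.1, piece (child q c) := by
  rw [piece, inflate_shift, inflate_tile]
  ext z
  simp only [mem_shift, Set.mem_iUnion, piece, child, sub_sub]

lemma piece_child_subset {q : Fin 4 × ℂ} {c : ℕ × Fin 4} (hc : c ∈ children q.1) :
    piece (child q c) ⊆ inflate (piece q) := by
  rw [inflate_piece]
  exact Set.subset_biUnion_of_mem (u := fun c => piece (child q c)) hc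

lemma image_pow_tile (n : ℕ) (i : Fin 4) :
    (fun z : ℂ => radix ^ n * z) '' tile i = ⋃ p ∈ patch n i, piece p := by
  induction n with
  | zero => simp [patch, piece, shift_zero]
  | succ n ih =>
    have h : (fun z : ℂ => radix ^ (n + 1) * z) '' tile i =
        inflate ((fun z : ℂ => radix ^ n * z) '' tile i) := by
      rw [inflate, Set.image_image]
      simp only [pow_succ', mul_assoc]
    rw [h, ih]
    ext z
    simp only [mem_inflate, Set.mem_iUnion, mem_patch_succ]
    constructor
    · rintro ⟨q, hq, hz⟩
      rw [← mem_inflate, inflate_piece] at hz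
      simp only [Set.mem_iUnion] at hz
      obtain ⟨c, hc, hz⟩ := hz
      exact ⟨_, ⟨q, hq, c, hc, rfl⟩, hz⟩
    · rintro ⟨_, ⟨q, hq, c, hc, rfl⟩, hz⟩
      exact ⟨q, hq, mem_inflate.1 (piece_child_subset hc hz)⟩

lemma finite_patch (n : ℕ) (i : Fin 4) : (patch n i).Finite := by
  induction n with
  | zero => exact Set.finite_singleton _
  | succ n ih =>
    have h : patch (n + 1) i = ⋃ q ∈ patch n i, (child q) '' (children q.1 : Set (ℕ × Fin 4)) := by
      ext p
      simp only [mem_patch_succ, Set.mem_iUnion, Set.mem_image, Finset.mem_coe, exists_prop, eq_comm]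
    rw [h]
    exact ih.biUnion fun q _ => (Finset.finite_toSet _).image _

/-- The type `i - 1` has a child of type `i` with digit `0`, so the patches are nested. -/
lemma patch_subset_patch_succ (n : ℕ) (i : Fin 4) : patch n i ⊆ patch (n + 1) (i - 1) := by
  induction n with
  | zero =>
    rintro p rfl
    refine ⟨(i - 1, 0), rfl, (0, i), ?_, by simp⟩
    fin_cases i <;> decide
  | succ n ih =>
    rintro p ⟨q, hq, c, hc, rfl⟩
    exact ⟨q, ih hq, c, hc, rfl⟩

lemma exists_patch_subset {m n : ℕ} (h : m ≤ n) (i : Fin 4) : ∃ j, patch m i ⊆ patch n j := by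
  induction n, h using Nat.le_induction with
  | base => exact ⟨i, subset_rfl⟩
  | succ n _ ih =>
    obtain ⟨j, hj⟩ := ih
    exact ⟨j - 1, hj.trans (patch_subset_patch_succ n j)⟩

/-! ### Essential disjointness -/

lemma volume_re_eq (a : ℝ) : volume {z : ℂ | z.re = a} = 0 := by
  have h := Complex.volume_preserving_equiv_real_prod.measure_preimage
    (s := {a} ×ˢ Set.univ) ((measurableSet_singleton a).prod .univ).nullMeasurableSet
  have e : {z : ℂ | z.re = a} = Complex.measurableEquivRealProd ⁻¹' ({a} ×ˢ Set.univ) := by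
    ext z
    simp
  rw [e, h, Measure.volume_eq_prod, Measure.prod_prod]
  simp

lemma volume_im_eq (a : ℝ) : volume {z : ℂ | z.im = a} = 0 := by
  have h := Complex.volume_preserving_equiv_real_prod.measure_preimage
    (s := Set.univ ×ˢ {a}) (MeasurableSet.univ.prod (measurableSet_singleton a)).nullMeasurableSet
  have e : {z : ℂ | z.im = a} = Complex.measurableEquivRealProd ⁻¹' (Set.univ ×ˢ {a}) := by
    ext z
    simp
  rw [e, h, Measure.volume_eq_prod, Measure.prod_prod]
  simp

lemma volume_shift (w : ℂ) (s : Set ℂ) : volume (shift w s) = volume s := by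
  rw [shift, Set.image_add_left, measure_preimage_add]

lemma volume_inflate_eq_zero {s : Set ℂ} (h : volume s = 0) : volume (inflate s) = 0 := by
  have := Measure.addHaar_image_linearMap volume (LinearMap.mulLeft ℝ radix) s
  rw [h, mul_zero] at this
  exact this

lemma inflate_inter (s t : Set ℂ) : inflate (s ∩ t) = inflate s ∩ inflate t := by
  ext z
  simp only [mem_inflate, Set.mem_inter_iff]

/-- Different tile types lie in different quadrants. -/
lemma volume_tile_inter_tile {i j : Fin 4} (h : i ≠ j) : volume (tile i ∩ tile j) = 0 := by
  have hsub : tile i ∩ tile j ⊆ {z : ℂ | z.re = 0} ∪ {z : ℂ | z.im = 0} := by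
    rintro z ⟨hi, hj⟩
    obtain ⟨x, y, rfl⟩ := exists_eq_mk z
    rw [mk_mem_tile] at hi hj
    suffices x = 0 ∨ y = 0 by
      refine this.imp id ?_
      rintro rfl
      simp
    fin_cases i <;> fin_cases j <;>
      simp only [tileLeft, tileRight, tileBottom, tileTop] at hi hj <;> simp at h hi hj <;>
      first
        | (left; linarith [hi.1.1, hi.1.2, hj.1.1, hj.1.2])
        | (right; linarith [hi.2.1, hi.2.2, hj.2.1, hj.2.2])
  exact measure_mono_null hsub (measure_union_null (volume_re_eq 0) (volume_im_eq 0))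

/-- Two pieces of one inflated tile meet only on the line `re = 2 - φ = φ⁻²`. -/
lemma volume_children_inter {i : Fin 4} {c d : ℕ × Fin 4} (hc : c ∈ children i)
    (hd : d ∈ children i) (h : c ≠ d) :
    volume (shift (c.1 : ℂ) (tile c.2) ∩ shift (d.1 : ℂ) (tile d.2)) = 0 := by
  have hsub : shift (c.1 : ℂ) (tile c.2) ∩ shift (d.1 : ℂ) (tile d.2) ⊆
      {z : ℂ | z.re = 2 - φ} := by
    rintro z ⟨hz, hz'⟩
    replace hz := (mem_tile.1 (mem_shift.1 hz)).1
    replace hz' := (mem_tile.1 (mem_shift.1 hz')).1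
    fin_cases i <;> simp [children] at hc hd
    · exact absurd (hc.trans hd.symm) h
    · exact absurd (hc.trans hd.symm) h
    all_goals
      rcases hc with rfl | rfl <;> rcases hd with rfl | rfl <;>
      simp [tileLeft, tileRight] at h hz hz' ⊢ <;> linarith
  exact measure_mono_null hsub (volume_re_eq _)

lemma volume_child_inter {q : Fin 4 × ℂ} {c d : ℕ × Fin 4} (hc : c ∈ children q.1)
    (hd : d ∈ children q.1) (h : c ≠ d) : volume (piece (child q c) ∩ piece (child q d)) = 0 := by
  have e : piece (child q c) ∩ piece (child q d) = shift (radix * q.2)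
      (shift (c.1 : ℂ) (tile c.2) ∩ shift (d.1 : ℂ) (tile d.2)) := by
    ext z
    simp only [piece, child, Set.mem_inter_iff, mem_shift, sub_sub]
  rw [e, volume_shift, volume_children_inter hc hd h]

lemma volume_piece_inter (n : ℕ) : ∀ {i j : Fin 4} {p q : Fin 4 × ℂ}, p ∈ patch n i →
    q ∈ patch n j → p ≠ q → volume (piece p ∩ piece q) = 0 := by
  induction n with
  | zero =>
    intro i j p q hp hq h
    rw [mem_patch_zero] at hp hq
    subst hp hq
    simp only [piece, shift_zero]
    exact volume_tile_inter_tile fun e => h (by rw [e])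
  | succ n ih =>
    rintro i j _ _ ⟨p, hp, c, hc, rfl⟩ ⟨q, hq, d, hd, rfl⟩ h
    by_cases hpq : p = q
    · subst hpq
      exact volume_child_inter hc hd fun e => h (by rw [e])
    · refine measure_mono_null
        (Set.inter_subset_inter (piece_child_subset hc) (piece_child_subset hd)) ?_
      rw [← inflate_inter]
      exact volume_inflate_eq_zero (ih hp hq hpq)

lemma volume_piece_pos (p : Fin 4 × ℂ) : 0 < volume (piece p) := by
  rw [piece, volume_shift, tile_eq]
  have h1 := Real.one_lt_goldenRatio
  have h2 := golden_lt_two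
  have hne : tileLeft p.1 < tileRight p.1 ∧ tileBottom p.1 < tileTop p.1 := by
    generalize p.1 = i
    fin_cases i <;> simp [tileLeft, tileRight, tileBottom, tileTop] <;> try constructor
    all_goals linarith
  have hne2 := mul_lt_mul_of_pos_left hne.2 sqrt_golden_pos
  have ho : IsOpen (Set.Ioo (tileLeft p.1) (tileRight p.1) ×ℂ
      Set.Ioo (√φ * tileBottom p.1) (√φ * tileTop p.1)) := isOpen_Ioo.reProdIm isOpen_Ioo
  refine (ho.measure_pos volume ?_).trans_le (measure_mono ?_)
  · obtain ⟨x, hx⟩ := Set.nonempty_Ioo.2 hne.1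
    obtain ⟨y, hy⟩ := Set.nonempty_Ioo.2 hne2
    exact ⟨⟨x, y⟩, hx, hy⟩
  · rintro z ⟨hx, hy⟩
    exact ⟨Set.Ioo_subset_Icc_self hx, Set.Ioo_subset_Icc_self hy⟩

/-- A piece of a subdivision determines the piece of the previous level it comes from: a common
child of two different pieces would be contained in a set of measure `0`. -/
lemma eq_of_child_eq {n : ℕ} {i : Fin 4} {p q : Fin 4 × ℂ} {c d : ℕ × Fin 4}
    (hp : p ∈ patch n i) (hq : q ∈ patch n i) (hc : c ∈ children p.1) (hd : d ∈ children q.1)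
    (h : child p c = child q d) : p = q := by
  by_contra hpq
  refine (volume_piece_pos (child p c)).ne' (measure_mono_null
    (Set.subset_inter (piece_child_subset hc) (h ▸ piece_child_subset hd)) ?_)
  rw [← inflate_inter]
  exact volume_inflate_eq_zero (volume_piece_inter n hp hq hpq)

/-! ### The tessellation -/

/-- The four tile types together form a neighbourhood of `0`. -/
lemma exists_mem_tile {x y : ℝ} (hx : |x| ≤ 1 / 4) (hy : |y| ≤ 1 / 4) :
    ∃ i, (⟨x, √φ * y⟩ : ℂ) ∈ tile i := by
  have h1 : 1.6 < φ := by
    have := Real.goldenRatio_sq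
    nlinarith [Real.one_lt_goldenRatio]
  have h2 : φ < 1.7 := by
    have := Real.goldenRatio_sq
    nlinarith [Real.one_lt_goldenRatio]
  rw [abs_le] at hx hy
  simp only [mk_mem_tile]
  rcases le_total 0 x with hx0 | hx0 <;> rcases le_total 0 y with hy0 | hy0
  · refine ⟨0, ?_⟩
    simp [tileLeft, tileRight, tileBottom, tileTop]
    refine ⟨⟨?_, ?_⟩, ?_, ?_⟩ <;> linarith
  · refine ⟨3, ?_⟩
    simp [tileLeft, tileRight, tileBottom, tileTop]
    refine ⟨⟨?_, ?_⟩, ?_, ?_⟩ <;> linarith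
  · refine ⟨1, ?_⟩
    simp [tileLeft, tileRight, tileBottom, tileTop]
    refine ⟨⟨?_, ?_⟩, ?_, ?_⟩ <;> linarith
  · refine ⟨2, ?_⟩
    simp [tileLeft, tileRight, tileBottom, tileTop]
    refine ⟨⟨?_, ?_⟩, ?_, ?_⟩ <;> linarith

lemma sUnion_tessellation : ⋃₀ tessellation = Set.univ := by
  refine Set.eq_univ_of_forall fun z => ?_
  have ht : Tendsto (fun n : ℕ => ‖z‖ * (‖radix‖⁻¹) ^ n) atTop (𝓝 (‖z‖ * 0)) :=
    (tendsto_pow_atTop_nhds_zero_of_lt_one (by positivity)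
      (inv_lt_one_of_one_lt₀ one_lt_norm_radix)).const_mul _
  rw [mul_zero] at ht
  obtain ⟨n, hn⟩ := (ht.eventually (gt_mem_nhds (show (0 : ℝ) < 1 / 4 by norm_num))).exists
  have hw : ‖z / radix ^ n‖ < 1 / 4 := by
    rwa [norm_div, norm_pow, div_eq_mul_inv, ← inv_pow]
  have hz : z = radix ^ n * (z / radix ^ n) :=
    (mul_div_cancel₀ _ (pow_ne_zero n radix_ne_zero)).symm
  generalize z / radix ^ n = w at hw hz
  obtain ⟨x, y, rfl⟩ := exists_eq_mk w
  have hx := (Complex.abs_re_le_norm _).trans hw.le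
  have hy := (Complex.abs_im_le_norm _).trans hw.le
  have h1 : 1 ≤ √φ := norm_radix ▸ one_lt_norm_radix.le
  have hy' : |y| ≤ 1 / 4 := by
    rw [abs_mul, abs_of_pos sqrt_golden_pos] at hy
    nlinarith [abs_nonneg y]
  obtain ⟨i, hi⟩ := exists_mem_tile hx hy'
  have hm : z ∈ ⋃ p ∈ patch n i, piece p := by
    rw [← image_pow_tile]
    exact ⟨_, hi, hz.symm⟩
  simp only [Set.mem_iUnion] at hm
  obtain ⟨p, hp, hzp⟩ := hm
  exact ⟨_, ⟨n, i, p, hp, rfl⟩, hzp⟩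

lemma isTessellation_tessellation : IsTessellation tessellation := by
  refine ⟨sUnion_tessellation, ?_⟩
  rintro _ ⟨m, i, p, hp, rfl⟩ _ ⟨n, j, q, hq, rfl⟩ h
  obtain ⟨i', hi⟩ := exists_patch_subset (le_max_left m n) i
  obtain ⟨j', hj⟩ := exists_patch_subset (le_max_right m n) j
  exact volume_piece_inter _ (hi hp) (hj hq) fun e => h (by rw [e])

lemma exists_inflate_eq_sUnion {t : Set ℂ} (ht : t ∈ tessellation) :
    ∃ S ⊆ tessellation, S.Finite ∧ inflate t = ⋃₀ S := by
  obtain ⟨n, i, q, hq, rfl⟩ := ht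
  refine ⟨(fun c => piece (child q c)) '' (children q.1 : Set (ℕ × Fin 4)), ?_,
    (Finset.finite_toSet _).image _, ?_⟩
  · rintro _ ⟨c, hc, rfl⟩
    exact ⟨n + 1, i, child q c, ⟨q, hq, c, hc, rfl⟩, rfl⟩
  · rw [Set.sUnion_image]
    exact inflate_piece q

/-! ### Counting the tiles -/

lemma partitionMatrix_eq :
    partitionMatrix = !![0, 1, 0, 0; 0, 0, 1, 0; 0, 0, 1, 1; 1, 1, 0, 0] := by
  decide

/-- The offsets of the pieces of type `j` in the subdivision of `ρ ^ n R_i`. -/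
def offsets (n : ℕ) (i j : Fin 4) : Set ℂ := {ω | (j, ω) ∈ patch n i}

/-- The offset of a child with digit `δ`. -/
noncomputable def digitMap (δ : ℕ) (z : ℂ) : ℂ := radix * z + δ

lemma digitMap_injective (δ : ℕ) : Function.Injective (digitMap δ) := fun _ _ h =>
  mul_left_cancel₀ radix_ne_zero (add_right_cancel h)

lemma finite_offsets (n : ℕ) (i j : Fin 4) : (offsets n i j).Finite :=
  (finite_patch n i).preimage (f := fun ω => (j, ω)) fun _ _ _ _ h => (Prod.ext_iff.1 h).2

lemma mem_offsets_succ {n : ℕ} {i j : Fin 4} {ω : ℂ} : ω ∈ offsets (n + 1) i j ↔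
    ∃ k, ∃ δ, (δ, j) ∈ children k ∧ ω ∈ digitMap δ '' offsets n i k := by
  constructor
  · rintro ⟨⟨k, z⟩, hq, ⟨δ, j'⟩, hc, h⟩
    obtain ⟨rfl, hω⟩ := Prod.ext_iff.1 h
    exact ⟨k, δ, hc, z, hq, hω.symm⟩
  · rintro ⟨k, δ, hc, z, hq, rfl⟩
    exact ⟨(k, z), hq, (δ, j), hc, rfl⟩

lemma disjoint_digitMap {n : ℕ} {i j k l : Fin 4} {δ ε : ℕ} (hk : (δ, j) ∈ children k)
    (hl : (ε, j) ∈ children l) (h : k ≠ l) :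
    Disjoint (digitMap δ '' offsets n i k) (digitMap ε '' offsets n i l) := by
  rw [Set.disjoint_left]
  rintro _ ⟨y, hy, rfl⟩ ⟨z, hz, hyz⟩
  refine h (congrArg Prod.fst (eq_of_child_eq (p := (k, y)) (q := (l, z)) hy hz hk hl ?_))
  exact Prod.ext rfl hyz.symm

lemma tileCount_eq_ncard (n : ℕ) (i j : Fin 4) : tileCount n i j = (offsets n i j).ncard := rfl

lemma ncard_digitMap (δ n : ℕ) (i j : Fin 4) :
    (digitMap δ '' offsets n i j).ncard = tileCount n i j :=
  Set.ncard_image_of_injective _ (digitMap_injective δ)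

lemma ncard_digitMap_union {n : ℕ} {i j k l : Fin 4} {δ ε : ℕ} (hk : (δ, j) ∈ children k)
    (hl : (ε, j) ∈ children l) (h : k ≠ l) :
    (digitMap δ '' offsets n i k ∪ digitMap ε '' offsets n i l).ncard =
      tileCount n i k + tileCount n i l := by
  rw [Set.ncard_union_eq (disjoint_digitMap hk hl h) ((finite_offsets _ _ _).image _)
    ((finite_offsets _ _ _).image _), ncard_digitMap, ncard_digitMap]

lemma tileCount_zero (i j : Fin 4) : tileCount 0 i j = if i = j then 1 else 0 := by
  have h : offsets 0 i j = if i = j then {0} else ∅ := by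
    ext ω
    change (j, ω) ∈ patch 0 i ↔ _
    rw [mem_patch_zero]
    split_ifs with hij
    · simp [hij]
    · simp [Ne.symm hij]
  rw [tileCount_eq_ncard, h]
  split_ifs <;> simp

lemma tileCount_succ_zero (n : ℕ) (i : Fin 4) : tileCount (n + 1) i 0 = tileCount n i 3 := by
  have h : offsets (n + 1) i 0 = digitMap 0 '' offsets n i 3 := by
    ext ω
    rw [mem_offsets_succ]
    constructor
    · rintro ⟨k, δ, hc, h⟩
      fin_cases k <;> simp [children] at hc
      subst hc
      exact h
    · exact fun h => ⟨3, 0, by decide, h⟩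
  rw [tileCount_eq_ncard, h, ncard_digitMap]

lemma tileCount_succ_one (n : ℕ) (i : Fin 4) :
    tileCount (n + 1) i 1 = tileCount n i 0 + tileCount n i 3 := by
  have h : offsets (n + 1) i 1 = digitMap 0 '' offsets n i 0 ∪ digitMap 1 '' offsets n i 3 := by
    ext ω
    rw [mem_offsets_succ]
    constructor
    · rintro ⟨k, δ, hc, h⟩
      fin_cases k <;> simp [children] at hc <;> subst hc
      · exact Or.inl h
      · exact Or.inr h
    · rintro (h | h)
      · exact ⟨0, 0, by decide, h⟩
      · exact ⟨3, 1, by decide, h⟩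
  rw [tileCount_eq_ncard, h, ncard_digitMap_union (j := 1) (by decide) (by decide) (by decide)]

lemma tileCount_succ_two (n : ℕ) (i : Fin 4) :
    tileCount (n + 1) i 2 = tileCount n i 1 + tileCount n i 2 := by
  have h : offsets (n + 1) i 2 = digitMap 0 '' offsets n i 1 ∪ digitMap 1 '' offsets n i 2 := by
    ext ω
    rw [mem_offsets_succ]
    constructor
    · rintro ⟨k, δ, hc, h⟩
      fin_cases k <;> simp [children] at hc <;> subst hc
      · exact Or.inl h
      · exact Or.inr h
    · rintro (h | h)
      · exact ⟨1, 0, by decide, h⟩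
      · exact ⟨2, 1, by decide, h⟩
  rw [tileCount_eq_ncard, h, ncard_digitMap_union (j := 2) (by decide) (by decide) (by decide)]

lemma tileCount_succ_three (n : ℕ) (i : Fin 4) : tileCount (n + 1) i 3 = tileCount n i 2 := by
  have h : offsets (n + 1) i 3 = digitMap 0 '' offsets n i 2 := by
    ext ω
    rw [mem_offsets_succ]
    constructor
    · rintro ⟨k, δ, hc, h⟩
      fin_cases k <;> simp [children] at hc
      subst hc
      exact h
    · exact fun h => ⟨2, 0, by decide, h⟩
  rw [tileCount_eq_ncard, h, ncard_digitMap]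

lemma tileCount_eq_pow (n : ℕ) (i j : Fin 4) : tileCount n i j = (partitionMatrix ^ n) i j := by
  induction n generalizing j with
  | zero => rw [tileCount_zero, pow_zero, Matrix.one_apply]
  | succ n ih =>
    rw [pow_succ, Matrix.mul_apply, Fin.sum_univ_four, ← ih, ← ih, ← ih, ← ih, partitionMatrix_eq]
    fin_cases j
    · simpa using tileCount_succ_zero n i
    · simpa using tileCount_succ_one n i
    · simpa using tileCount_succ_two n i
    · simpa using tileCount_succ_three n i

/-! ### The spectrum of the partition matrix -/

lemma mem_spectrum_iff {K : Type*} [Field K] (z : K) :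
    z ∈ spectrum K (partitionMatrix.map (fun m : ℕ => (m : K))) ↔
      (z ^ 2 + 1) * (z ^ 2 - z - 1) = 0 := by
  rw [spectrum.mem_iff, Matrix.isUnit_iff_isUnit_det, isUnit_iff_ne_zero, not_not,
    partitionMatrix_eq]
  have h : (algebraMap K (Matrix (Fin 4) (Fin 4) K) z - (!![0, 1, 0, 0; 0, 0, 1, 0; 0, 0, 1, 1;
      1, 1, 0, 0] : Matrix (Fin 4) (Fin 4) ℕ).map (fun m : ℕ => (m : K))) =
      !![z, -1, 0, 0; 0, z, -1, 0; 0, 0, z - 1, -1; -1, -1, 0, z] := by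
    ext i j
    rw [Matrix.sub_apply, Matrix.algebraMap_matrix_apply]
    fin_cases i <;> fin_cases j <;> simp
  have hd : Matrix.det !![z, -1, 0, 0; 0, z, -1, 0; 0, 0, z - 1, -1; -1, -1, 0, z] =
      (z ^ 2 + 1) * (z ^ 2 - z - 1) := by
    simp [Matrix.det_succ_row_zero, Fin.sum_univ_succ, Fin.succAbove]
    ring
  rw [h, hd]

lemma golden_factor {R : Type*} [CommRing R] {f g : R} (hs : f + g = 1) (hp : f * g = -1) (z : R) :
    z ^ 2 - z - 1 = (z - f) * (z - g) := by
  linear_combination z * hs - hp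

lemma isGreatest_spectrum :
    IsGreatest (spectrum ℝ (partitionMatrix.map (fun m : ℕ => (m : ℝ)))) φ := by
  constructor
  · rw [mem_spectrum_iff, Real.goldenRatio_sq]
    ring
  · intro z hz
    rw [mem_spectrum_iff] at hz
    have h2 : z ^ 2 - z - 1 = 0 := (mul_eq_zero.1 hz).resolve_left (by positivity)
    rw [golden_factor Real.goldenRatio_add_goldenConj Real.goldenRatio_mul_goldenConj] at h2
    rcases mul_eq_zero.1 h2 with h | h
    · linarith
    · linarith [Real.goldenConj_neg, Real.goldenRatio_pos]

lemma abs_goldenConj_lt : |ψ| < 2 / 3 := by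
  have h := Real.goldenConj_sq
  have h1 := Real.goldenConj_neg
  rw [abs_of_neg h1]
  nlinarith

lemma norm_lt_of_mem_spectrum {z : ℂ}
    (hz : z ∈ spectrum ℂ (partitionMatrix.map (fun m : ℕ => (m : ℂ)))) (h : z ≠ (φ : ℂ)) :
    ‖z‖ < φ := by
  have h1 := Real.one_lt_goldenRatio
  rw [mem_spectrum_iff] at hz
  rcases mul_eq_zero.1 hz with h2 | h2
  · have h3 : ‖z‖ ^ 2 = 1 := by
      rw [← norm_pow, eq_neg_of_add_eq_zero_left h2, norm_neg, norm_one]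
    nlinarith [norm_nonneg z]
  · rw [golden_factor (f := (φ : ℂ)) (g := (ψ : ℂ))
      (by exact_mod_cast Real.goldenRatio_add_goldenConj)
      (by exact_mod_cast Real.goldenRatio_mul_goldenConj)] at h2
    have h3 := sub_eq_zero.1 ((mul_eq_zero.1 h2).resolve_left (sub_ne_zero.2 h))
    rw [h3, Complex.norm_real, Real.norm_eq_abs]
    linarith [abs_goldenConj_lt]

/-! ### The densities of the tile types -/

/-- A left eigenvector of the partition matrix for the eigenvalue `φ`. -/
noncomputable def leftPerron : Fin 4 → ℝ := ![1, φ, φ + 1, φ]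

/-- A right eigenvector of the partition matrix for the eigenvalue `φ`. -/
noncomputable def rightPerron : Fin 4 → ℝ := ![1, φ, φ + 1, φ]

lemma add_mul_goldenRatio_eq_zero {p q : ℚ} (h : (p : ℝ) + q * φ = 0) : p = 0 ∧ q = 0 := by
  have hq : q = 0 := by
    by_contra hq
    refine Real.goldenRatio_irrational ⟨-p / q, ?_⟩
    have : (q : ℝ) ≠ 0 := by exact_mod_cast hq
    push_cast
    rw [div_eq_iff this]
    linear_combination -h
  subst hq
  simpa using h

/-- The hypothesis says that `p + q φ` is not a rational multiple of `2 + 3 φ`. -/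
lemma irrational_div {p q : ℚ} (h : 3 * p ≠ 2 * q) :
    Irrational (((p : ℝ) + q * φ) / (2 + 3 * φ)) := by
  rintro ⟨r, hr⟩
  have h0 : 2 + 3 * φ ≠ 0 := by linarith [Real.goldenRatio_pos]
  rw [eq_div_iff h0] at hr
  obtain ⟨h1, h2⟩ := add_mul_goldenRatio_eq_zero (p := p - 2 * r) (q := q - 3 * r)
    (by push_cast; linarith)
  exact h (by linarith)

lemma irrational_density (j : Fin 4) : Irrational (leftPerron j / (2 + 3 * φ)) := by
  fin_cases j
  · simpa [leftPerron] using irrational_div (p := 1) (q := 0) (by norm_num)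
  · simpa [leftPerron] using irrational_div (p := 0) (q := 1) (by norm_num)
  · simpa [leftPerron, add_comm] using irrational_div (p := 1) (q := 1) (by norm_num)
  · simpa [leftPerron] using irrational_div (p := 0) (q := 1) (by norm_num)

/-- The tile counts grow like `φ ^ n` times the left eigenvector. The pairings of the row of
counts with right eigenvectors for `φ` and `ψ` are geometric progressions `F` and `G`, those with
the eigenvectors for `± i` form a sequence `P`, `Q` rotated by a right angle at each step, and the
counts are linear combinations of these four. -/
lemma tendsto_tileCount_div_pow (i j : Fin 4) :
    Tendsto (fun n => (tileCount n i j : ℝ) / φ ^ n) atTop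
      (𝓝 (rightPerron i * (2 - φ) / 5 * leftPerron j)) := by
  have hφ := Real.goldenRatio_sq
  have hψ := Real.goldenConj_sq
  have hφ0 := Real.goldenRatio_ne_zero
  have h1 := Real.one_lt_goldenRatio
  have h5 : (√5 : ℝ) * √5 = 5 := Real.mul_self_sqrt (by norm_num)
  have h50 : (√5 : ℝ) ≠ 0 := by positivity
  have hsub : φ - ψ = √5 := Real.goldenRatio_sub_goldenConj
  have hadd : φ + ψ = 1 := Real.goldenRatio_add_goldenConj
  set a : ℕ → ℝ := fun n => (tileCount n i 0 : ℝ) with ha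
  set b : ℕ → ℝ := fun n => (tileCount n i 1 : ℝ) with hb
  set c : ℕ → ℝ := fun n => (tileCount n i 2 : ℝ) with hc
  set d : ℕ → ℝ := fun n => (tileCount n i 3 : ℝ) with hd
  have ea : ∀ n, a (n + 1) = d n := fun n => by simp only [ha, hd, tileCount_succ_zero]
  have eb : ∀ n, b (n + 1) = a n + d n := fun n => by
    simp only [ha, hb, hd, tileCount_succ_one, Nat.cast_add]
  have ec : ∀ n, c (n + 1) = b n + c n := fun n => by
    simp only [hb, hc, tileCount_succ_two, Nat.cast_add]
  have ed : ∀ n, d (n + 1) = c n := fun n => by simp only [hc, hd, tileCount_succ_three]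
  have hF : ∀ n, a n + φ * b n + (φ + 1) * c n + φ * d n = rightPerron i * φ ^ n := by
    intro n
    induction n with
    | zero =>
      simp only [ha, hb, hc, hd, tileCount_zero]
      fin_cases i <;> simp [rightPerron]
    | succ n ih =>
      rw [ea, eb, ec, ed, pow_succ, ← mul_assoc, ← ih]
      linear_combination (-(b n + c n + d n)) * hφ
  obtain ⟨g, hG⟩ : ∃ g, ∀ n, a n + ψ * b n + (ψ + 1) * c n + ψ * d n = g * ψ ^ n := by
    refine ⟨a 0 + ψ * b 0 + (ψ + 1) * c 0 + ψ * d 0, fun n => ?_⟩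
    induction n with
    | zero => simp
    | succ n ih =>
      rw [ea, eb, ec, ed, pow_succ, ← mul_assoc, ← ih]
      linear_combination (-(b n + c n + d n)) * hψ
  set P : ℕ → ℝ := fun n => a n - c n + d n with hP
  set Q : ℕ → ℝ := fun n => b n - d n with hQ
  obtain ⟨B, hPQ⟩ : ∃ B, ∀ n, P n ^ 2 + Q n ^ 2 = B := by
    refine ⟨P 0 ^ 2 + Q 0 ^ 2, fun n => ?_⟩
    induction n with
    | zero => rfl
    | succ n ih =>
      rw [← ih]
      simp only [hP, hQ, ea, eb, ec, ed]
      ring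
  have hpow : Tendsto (fun n : ℕ => (φ ^ n)⁻¹) atTop (𝓝 0) :=
    (tendsto_pow_atTop_atTop_of_one_lt h1).inv_tendsto_atTop
  have hbdd : ∀ X : ℕ → ℝ, (∀ n, X n ^ 2 ≤ B) → Tendsto (fun n => X n / φ ^ n) atTop (𝓝 0) := by
    intro X hX
    refine squeeze_zero_norm (a := fun n => √B * (φ ^ n)⁻¹) (fun n => ?_) ?_
    · rw [norm_div, norm_pow, Real.norm_eq_abs, Real.norm_of_nonneg Real.goldenRatio_pos.le,
        div_eq_mul_inv]
      gcongr
      exact Real.abs_le_sqrt (hX n)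
    · simpa using hpow.const_mul (√B)
  have tP := hbdd P fun n => by nlinarith [hPQ n, sq_nonneg (Q n)]
  have tQ := hbdd Q fun n => by nlinarith [hPQ n, sq_nonneg (P n)]
  have tF : Tendsto (fun n => (a n + φ * b n + (φ + 1) * c n + φ * d n) / φ ^ n) atTop
      (𝓝 (rightPerron i)) := by
    refine tendsto_const_nhds.congr fun n => ?_
    rw [hF, mul_div_cancel_right₀ _ (pow_ne_zero n hφ0)]
  have tG : Tendsto (fun n => (a n + ψ * b n + (ψ + 1) * c n + ψ * d n) / φ ^ n) atTop
      (𝓝 (g * 0)) := by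
    have hr : |ψ / φ| < 1 := by
      rw [abs_div, abs_of_pos Real.goldenRatio_pos, div_lt_one Real.goldenRatio_pos]
      linarith [abs_goldenConj_lt]
    refine ((tendsto_pow_atTop_nhds_zero_of_abs_lt_one hr).const_mul g).congr fun n => ?_
    rw [hG, div_pow, mul_div_assoc]
  rw [mul_zero] at tG
  -- `F - G = (φ - ψ) (b + c + d)`, which gives the growth of the sum `S = b + c + d`
  have tS := (tF.sub tG).div_const √5
  rw [sub_zero] at tS
  have hinv : (√5)⁻¹ = (2 * φ - 1) / 5 := by
    rw [eq_div_iff (by norm_num), inv_mul_eq_iff_eq_mul₀ h50]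
    linear_combination -h5 - √5 * (hsub + hadd)
  have eS : ∀ n, ((a n + φ * b n + (φ + 1) * c n + φ * d n) / φ ^ n -
      (a n + ψ * b n + (ψ + 1) * c n + ψ * d n) / φ ^ n) / √5 = (b n + c n + d n) / φ ^ n := by
    intro n
    have := pow_ne_zero n hφ0
    field_simp
    rw [← hsub]
    ring
  have tS' : Tendsto (fun n => (b n + c n + d n) / φ ^ n) atTop
      (𝓝 (rightPerron i * ((2 * φ - 1) / 5))) := by
    rw [← hinv, ← div_eq_mul_inv]
    exact tS.congr eS
  have td : Tendsto (fun n => d n / φ ^ n) atTop (𝓝 (rightPerron i * (2 - φ) / 5 * φ)) := by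
    -- `5 d = P - 2 Q - F + (2 + φ) S`, because `F = a + c + φ S`
    have := (((tP.sub (tQ.const_mul 2)).sub tF).add (tS'.const_mul (2 + φ))).div_const 5
    convert this using 2
    · simp only [hP, hQ]
      field_simp
      ring
    · linear_combination (-(rightPerron i) * 7 / 25) * hφ
  have tb : Tendsto (fun n => b n / φ ^ n) atTop (𝓝 (rightPerron i * (2 - φ) / 5 * φ)) := by
    have := td.add tQ
    rw [add_zero] at this
    refine this.congr fun n => ?_
    simp only [hQ]
    ring
  have tc : Tendsto (fun n => c n / φ ^ n) atTop (𝓝 (rightPerron i * (2 - φ) / 5 * (φ + 1))) := by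
    have := (tS'.sub tb).sub td
    convert this using 2
    · ring
    · linear_combination (-(rightPerron i) * 3 / 5) * hφ
  have ta : Tendsto (fun n => a n / φ ^ n) atTop (𝓝 (rightPerron i * (2 - φ) / 5 * 1)) := by
    have := (tP.add tc).sub td
    convert this using 2
    · simp only [hP]
      ring
    · ring
  fin_cases j
  · exact ta
  · exact tb
  · exact tc
  · exact td

lemma hasTypeDensity (j : Fin 4) : HasTypeDensity j (leftPerron j / (2 + 3 * φ)) := by
  intro i
  have h0 := Real.goldenRatio_pos
  have h2 := golden_lt_two
  set κ := rightPerron i * (2 - φ) / 5 with hκ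
  have hκ0 : κ ≠ 0 := by
    have hr : 0 < rightPerron i := by
      fin_cases i <;> simp [rightPerron, h0]
      linarith
    have : 0 < 2 - φ := by linarith
    positivity
  have hs : ∑ k, κ * leftPerron k = κ * (2 + 3 * φ) := by
    simp [Fin.sum_univ_four, leftPerron]
    ring
  have ht := (tendsto_tileCount_div_pow i j).div
    (tendsto_finsetSum Finset.univ fun k _ => tendsto_tileCount_div_pow i k)
    (by rw [hs]; exact mul_ne_zero hκ0 (by linarith))
  rw [hs, mul_div_mul_left _ _ hκ0] at ht
  refine ht.congr fun n => ?_
  rw [Pi.div_apply, ← Finset.sum_div]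
  exact div_div_div_cancel_right₀ (pow_ne_zero n h0.ne') _ _

/-! ### Absence of periods -/

/-- `x` is an element `a + b φ` of `ℤ[φ]` whose Galois conjugate has absolute value at
most `C`. -/
def ConjBound (C x : ℝ) : Prop := ∃ a b : ℤ, x = a + b * φ ∧ |(a : ℝ) + b * ψ| ≤ C

/-- The offsets are expansions in base `ρ` with digits `0` and `1`, and a Galois conjugate of `ρ`
lies inside the unit circle, so that the conjugates of the offsets are bounded. -/
lemma conjBound_of_mem_patch (n : ℕ) : ∀ {i : Fin 4} {p : Fin 4 × ℂ}, p ∈ patch n i →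
    ∃ x y : ℝ, p.2 = ⟨x, √φ * y⟩ ∧ ConjBound 3 x ∧ ConjBound 3 y := by
  induction n with
  | zero =>
    rintro i p rfl
    have h : ConjBound 3 0 := ⟨0, 0, by simp, by simp⟩
    exact ⟨0, 0, by apply Complex.ext <;> simp, h, h⟩
  | succ n ih =>
    rintro i _ ⟨⟨k, ω⟩, hq, ⟨δ, l⟩, hc, rfl⟩
    obtain ⟨x, y, hω, hx, a, b, hy, hab⟩ := ih hq
    replace hω : ω = ⟨x, √φ * y⟩ := hω
    have hδ : (δ : ℝ) ≤ 1 := by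
      have : δ ≤ 1 := by
        fin_cases k <;> simp [children] at hc <;> omega
      exact_mod_cast this
    refine ⟨δ - φ * y, x, ?_, ⟨δ - b, -(a + b), ?_, ?_⟩, hx⟩
    · simp only [hω, radix_mul_mk]
      apply Complex.ext <;> simp
      ring
    · rw [hy]
      push_cast
      linear_combination (-(b : ℝ)) * Real.goldenRatio_sq
    -- the conjugate of `δ - φ y` is `δ - ψ z`, `z` the conjugate of `y`, and `1 + 3 |ψ| ≤ 3`
    · have e : (((δ : ℤ) - b : ℤ) : ℝ) + ((-(a + b) : ℤ) : ℝ) * ψ = δ - ψ * (a + b * ψ) := by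
        push_cast
        linear_combination (b : ℝ) * Real.goldenConj_sq
      rw [e]
      calc |(δ : ℝ) - ψ * (a + b * ψ)| ≤ |(δ : ℝ)| + |ψ * (a + b * ψ)| := abs_sub _ _
        _ ≤ 1 + 2 / 3 * 3 := by
          rw [abs_mul, abs_of_nonneg (Nat.cast_nonneg δ)]
          have := abs_goldenConj_lt
          gcongr
        _ = 3 := by norm_num

lemma ConjBound.add {C D x y : ℝ} (hx : ConjBound C x) (hy : ConjBound D y) :
    ConjBound (C + D) (x + y) := by
  obtain ⟨a, b, rfl, hab⟩ := hx
  obtain ⟨c, d, rfl, hcd⟩ := hy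
  refine ⟨a + c, b + d, by push_cast; ring, ?_⟩
  have e : ((a + c : ℤ) : ℝ) + ((b + d : ℤ) : ℝ) * ψ = (a + b * ψ) + (c + d * ψ) := by
    push_cast
    ring
  rw [e]
  exact (abs_add_le _ _).trans (add_le_add hab hcd)

/-- An element of `ℤ[φ]` all of whose multiples have conjugates bounded by the same constant
is `0`. -/
lemma eq_zero_of_conjBound {C x : ℝ} (h : ∀ k : ℕ, ConjBound C (k * x)) : x = 0 := by
  obtain ⟨a, b, hx, -⟩ := h 1
  rw [Nat.cast_one, one_mul] at hx
  have key : ∀ k : ℕ, k * |(a : ℝ) + b * ψ| ≤ C := by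
    intro k
    obtain ⟨c, d, hk, hcd⟩ := h k
    obtain ⟨h1, h2⟩ := add_mul_goldenRatio_eq_zero (p := k * a - c) (q := k * b - d) (by
      push_cast
      rw [hx] at hk
      linarith)
    have h1' : (c : ℝ) = k * a := by exact_mod_cast (sub_eq_zero.1 h1).symm
    have h2' : (d : ℝ) = k * b := by exact_mod_cast (sub_eq_zero.1 h2).symm
    rw [h1', h2', mul_assoc, ← mul_add, abs_mul, Nat.abs_cast] at hcd
    exact hcd
  have h0 : (a : ℝ) + b * ψ = 0 := by
    by_contra hne
    obtain ⟨k, hk⟩ := exists_nat_gt (C / |(a : ℝ) + b * ψ|)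
    rw [div_lt_iff₀ (abs_pos.2 hne)] at hk
    exact absurd (key k) (not_le.2 hk)
  obtain ⟨h1, h2⟩ := add_mul_goldenRatio_eq_zero (p := a + b) (q := -b) (by
    push_cast
    linear_combination h0 - b * Real.goldenRatio_add_goldenConj)
  have hb : (b : ℝ) = 0 := by exact_mod_cast neg_eq_zero.1 h2
  have ha : (a : ℝ) = 0 := by simpa [hb] using h0
  simp [hx, ha, hb]

lemma conjBound_corner (i : Fin 4) :
    ConjBound 2 (tileLeft i) ∧ ConjBound 2 (tileBottom i) := by
  have h0 : ConjBound 2 0 := ⟨0, 0, by simp, by simp⟩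
  -- the conjugate of `1 - φ` is `1 - ψ = φ < 2`
  have h1 : ConjBound 2 (1 - φ) := by
    refine ⟨1, -1, by push_cast; ring, ?_⟩
    have e : ((1 : ℤ) : ℝ) + ((-1 : ℤ) : ℝ) * ψ = φ := by
      push_cast
      linear_combination -Real.goldenRatio_add_goldenConj
    rw [e, abs_of_pos Real.goldenRatio_pos]
    exact golden_lt_two.le
  fin_cases i <;> constructor <;> first | exact h0 | exact h1

lemma mk_mem_piece {i : Fin 4} {u v x y : ℝ} : (⟨x, √φ * y⟩ : ℂ) ∈ piece (i, ⟨u, √φ * v⟩) ↔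
    (tileLeft i ≤ x - u ∧ x - u ≤ tileRight i) ∧ (tileBottom i ≤ y - v ∧ y - v ≤ tileTop i) := by
  have e : (⟨x, √φ * y⟩ : ℂ) - ⟨u, √φ * v⟩ = ⟨x - u, √φ * (y - v)⟩ := by
    apply Complex.ext <;> simp
    ring
  rw [piece, mem_shift, e, mk_mem_tile]

/-- Equal pieces have the same lower left corner. -/
lemma corner_eq_of_piece_eq {i j : Fin 4} {u v x y : ℝ}
    (h : piece (i, ⟨u, √φ * v⟩) = piece (j, ⟨x, √φ * y⟩)) :
    u + tileLeft i = x + tileLeft j ∧ v + tileBottom i = y + tileBottom j := by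
  have hc : ∀ (k : Fin 4) (s t : ℝ),
      (⟨s + tileLeft k, √φ * (t + tileBottom k)⟩ : ℂ) ∈ piece (k, ⟨s, √φ * t⟩) := by
    intro k s t
    rw [mk_mem_piece]
    have := mk_mem_tile.1 (corner_mem_tile k)
    simpa using this
  have h1 := hc i u v
  rw [h, mk_mem_piece] at h1
  have h2 := hc j x y
  rw [← h, mk_mem_piece] at h2
  constructor <;> linarith [h1.1.1, h1.2.1, h2.1.1, h2.2.1]

lemma not_isPeriodic_tessellation : ¬ IsPeriodic tessellation := by
  rintro ⟨w, hw, hper⟩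
  have hmem : ∀ k : ℕ, piece (0, k * w) ∈ tessellation := by
    intro k
    induction k with
    | zero => exact ⟨0, 0, (0, 0), rfl, by simp [piece]⟩
    | succ k ih =>
      have : shift w (piece (0, k * w)) ∈ shift w '' tessellation := ⟨_, ih, rfl⟩
      rw [hper, piece, shift_shift] at this
      rw [piece]
      convert this using 2
      push_cast
      ring
  obtain ⟨x, y, rfl⟩ := exists_eq_mk w
  have key : ∀ k : ℕ, ConjBound (3 + 2) (k * x) ∧ ConjBound (3 + 2) (k * y) := by
    intro k
    obtain ⟨n, i, ⟨j, ω⟩, hp, h⟩ := hmem k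
    obtain ⟨u, v, hω, hu, hv⟩ := conjBound_of_mem_patch n hp
    replace hω : ω = ⟨u, √φ * v⟩ := hω
    subst hω
    have e : (k : ℂ) * ⟨x, √φ * y⟩ = ⟨k * x, √φ * (k * y)⟩ := by
      apply Complex.ext <;> simp
      ring
    rw [e] at h
    obtain ⟨h1, h2⟩ := corner_eq_of_piece_eq h
    simp only [tileLeft, tileBottom, Matrix.cons_val_zero, add_zero] at h1 h2
    rw [h1, h2]
    exact ⟨hu.add (conjBound_corner j).1, hv.add (conjBound_corner j).2⟩
  have hx := eq_zero_of_conjBound fun k => (key k).1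
  have hy := eq_zero_of_conjBound fun k => (key k).2
  subst hx hy
  exact hw (by apply Complex.ext <;> simp)

end SpecialTessellation

theorem mainTheorem7 :
    -- the four rectangles are the unique solution of the set equations
    (IsTileSystem tile ∧ ∀ R : Fin 4 → Set ℂ, IsTileSystem R → R = tile) ∧
    -- the inflations of the tiles are subdivided into tiles
    (∀ (n : ℕ) (i : Fin 4),
      (fun z : ℂ => radix ^ n * z) '' tile i = ⋃ p ∈ patch n i, shift p.2 (tile p.1)) ∧
    -- the tiles form a tessellation of the plane, and it is inflationary with radix `ρ`
    IsTessellation tessellation ∧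
    (∀ t ∈ tessellation, ∃ S ⊆ tessellation, S.Finite ∧ inflate t = ⋃₀ S) ∧
    -- the partition matrix, its powers and its Perron eigenvalue
    partitionMatrix = !![0, 1, 0, 0; 0, 0, 1, 0; 0, 0, 1, 1; 1, 1, 0, 0] ∧
    (∀ (n : ℕ) (i j : Fin 4), tileCount n i j = (partitionMatrix ^ n) i j) ∧
    IsGreatest (spectrum ℝ (partitionMatrix.map (fun m : ℕ => (m : ℝ)))) Real.goldenRatio ∧
    (∀ z ∈ spectrum ℂ (partitionMatrix.map (fun m : ℕ => (m : ℂ))),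
      z ≠ (Real.goldenRatio : ℂ) → ‖z‖ < Real.goldenRatio) ∧
    -- the tile type densities exist and are irrational
    (∀ j : Fin 4, ∃ d : ℝ, Irrational d ∧ HasTypeDensity j d) ∧
    -- the tessellation is not periodic
    ¬ IsPeriodic tessellation := by
  refine ⟨⟨isTileSystem_tile, fun R hR => funext fun i => (hR.subset isTileSystem_tile i).antisymm
    (isTileSystem_tile.subset hR i)⟩, image_pow_tile, isTessellation_tessellation,
    fun t ht => exists_inflate_eq_sUnion ht, partitionMatrix_eq, tileCount_eq_pow,
    isGreatest_spectrum, fun z hz h => norm_lt_of_mem_spectrum hz h,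
    fun j => ⟨_, irrational_density j, hasTypeDensity j⟩, not_isPeriodic_tessellation⟩
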